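/- Let $M$ be a smooth $4$-dimensional manifold with a smooth Riemannian metric $g=\langle\cdot,\cdot\rangle$ and Levi-Civita connection $\nabla^g$. Let $T$ be a smooth $3$-form on $M$ and $s\in\mathbb{R}$, and let $\nabla$ be the connection on $TM$ given by $$\nabla_X Y=\nabla^g_XY+s\,T(X,Y,\cdot)^\sharp ,$$ where $T(X,Y,\cdot)^\sharp$ is the vector field with $\langle T(X,Y,\cdot)^\sharp,Z\rangle=T(X,Y,Z)$ for all $Z$. For a connection $D$ on $TM$ put $\operatorname{Riem}^D(X,Y)Z=D_XD_YZ-D_YD_XZ-D_{[X,Y]}Z$ and $\operatorname{riem}^D(X,Y,Z,W)=\langle \operatorname{Riem}^D(X,Y)Z,W\rangle$. Write $\operatorname{Riem},\operatorname{riem}$ for $D=\nabla$ and $\operatorname{riem}^g$ for $D=\nabla^g$, let $$\operatorname{riem}^A(X,Y,Z,W)=\tfrac12\big(\operatorname{riem}(X,Y,Z,W)-\operatorname{riem}(Z,W,X,Y)\big),$$ and, for an orthonormal basis $E_1,\dots,E_4$ of the tangent space at the point considered, let $\operatorname{ric}^g(X,Y)=\sum_i \operatorname{riem}^g(E_i,X,Y,E_i)$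 and $R^g=\sum_j\operatorname{ric}^g(E_j,E_j)$. For a $(k,0)$-tensor $S$ (in particular for differential forms, with no factor $1/k!$) let $\|S\|^2=\sum_{i_1,\dots,i_k}S(E_{i_1},\dots,E_{i_k})^2$, and let $\|\operatorname{Riem}\|^2=\|\operatorname{riem}\|^2$. The exterior derivative $dT$ is normalised by $$dT(X_0,\dots,X_3)=\sum_i(-1)^iX_i\big(T(\dots,\widehat{X_i},\dots)\big)+\sum_{i<j}(-1)^{i+j}T([X_i,X_j],\dots,\widehat{X_i},\dots,\widehat{X_j},\dots).$$ Then at every point of $M$ $$\|\operatorname{Riem}\|^2=\|\operatorname{riem}^g\|^2+\tfrac13 s^4\|T\|^4+\tfrac14 s^2\|dT\|^2-\tfrac13 s^2R^g\|T\|^2+4s^2B(T)+\|\operatorname{riem}^A\|^2 ,$$ where $$B(T)=\sum_{i,j,k}\operatorname{ric}^g(E_i,E_k)\,\big\langle T(E_i,E_j,\cdot)^\sharp,T(E_j,E_k,\cdot)^\sharp\big\rangle+\tfrac14R^g\|T\|^2 .$$ -/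

import Mathlib

open Bundle VectorField NormedSpace
open scoped Manifold ContDiff

noncomputable section

namespace SkewTorsion

/-! Throughout, `M` is a smooth manifold modelled on a finite-dimensional real space, and the class
`RiemannianBundle` on its tangent spaces is a Riemannian metric `g = ⟨·, ·⟩`; it is smooth by
`IsContMDiffRiemannianBundle I ∞`. Vector fields are sections `Π x : M, TangentSpace I x`. -/

set_option linter.unusedSectionVars false

variable {E : Type*} [NormedAddCommGroup E] [NormedSpace ℝ E] [FiniteDimensional ℝ E]
  [CompleteSpace E] {H : Type*} [TopologicalSpace H] {I : ModelWithCorners ℝ E H}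
  {M : Type*} [TopologicalSpace M] [ChartedSpace H M]

instance finiteDimensional_tangentSpace (x : M) : FiniteDimensional ℝ (TangentSpace I x) :=
  inferInstanceAs (FiniteDimensional ℝ E)

section Sharp

variable [RiemannianBundle (fun x : M ↦ TangentSpace I x)]

instance completeSpace_tangentSpace (x : M) : CompleteSpace (TangentSpace I x) :=
  FiniteDimensional.complete ℝ _

/-- The tangent vector `φ^♯` metrically dual to a covector `φ`. -/
def sharp (x : M) (φ : TangentSpace I x →L[ℝ] ℝ) : TangentSpace I x :=
  (InnerProductSpace.toDual ℝ (TangentSpace I x)).symm φ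

theorem inner_sharp (x : M) (φ : TangentSpace I x →L[ℝ] ℝ) (w : TangentSpace I x) :
    inner ℝ (sharp x φ) w = φ w := by
  simp [sharp]

theorem sharp_eq_of_forall (x : M) (φ : TangentSpace I x →L[ℝ] ℝ) (v : TangentSpace I x)
    (h : ∀ w, φ w = inner ℝ v w) : sharp x φ = v :=
  ext_inner_right ℝ fun w ↦ by rw [inner_sharp, h]

end Sharp

section LeviCivita

variable [RiemannianBundle (fun x : M ↦ TangentSpace I x)]

/-- The Koszul expression, which equals `2 ⟨∇^g_X Y, Z⟩`. -/
def koszul (X Y Z : Π x : M, TangentSpace I x) (x : M) : ℝ :=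
  mvfderiv I (fun y ↦ (inner ℝ (Y y) (Z y) : ℝ)) x (X x)
    + mvfderiv I (fun y ↦ (inner ℝ (Z y) (X y) : ℝ)) x (Y x)
    - mvfderiv I (fun y ↦ (inner ℝ (X y) (Y y) : ℝ)) x (Z x)
    + inner ℝ (mlieBracket I X Y x) (Z x)
    - inner ℝ (mlieBracket I X Z x) (Y x)
    - inner ℝ (mlieBracket I Y Z x) (X x)

variable [IsManifold I ∞ M] [IsContMDiffRiemannianBundle I ∞ E (fun x : M ↦ TangentSpace I x)]

theorem mdiff_inner {X Y : Π x : M, TangentSpace I x} {x : M}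
    (hX : MDiffAt (T% X) x) (hY : MDiffAt (T% Y) x) :
    MDiffAt (fun y ↦ (inner ℝ (X y) (Y y) : ℝ)) x :=
  MDifferentiableAt.inner_bundle hX hY

theorem koszul_tensorial₁ {Y Z : Π x : M, TangentSpace I x} {x : M}
    (hY : MDiffAt (T% Y) x) (hZ : MDiffAt (T% Z) x) :
    TensorialAt I E (koszul (I := I) · Y Z x) x where
  smul {f X} hf hX := by
    have h1 := mdiff_inner hZ hX
    have h2 := mdiff_inner hX hY
    simp only [koszul, mlieBracket_smul_left hf hX, Pi.smul_apply', real_inner_smul_left,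
      real_inner_smul_right, inner_add_left, mvfderiv_fun_mul hf h1, mvfderiv_fun_mul hf h2]
    simp [real_inner_comm]
    ring
  add {X X'} hX hX' := by
    simp only [koszul, mlieBracket_add_left hX hX', Pi.add_apply, inner_add_left,
      inner_add_right, mvfderiv_fun_add (mdiff_inner hZ hX) (mdiff_inner hZ hX'),
      mvfderiv_fun_add (mdiff_inner hX hY) (mdiff_inner hX' hY)]
    simp
    ring

theorem koszul_tensorial₃ {X Y : Π x : M, TangentSpace I x} {x : M}
    (hX : MDiffAt (T% X) x) (hY : MDiffAt (T% Y) x) :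
    TensorialAt I E (koszul (I := I) X Y · x) x where
  smul {f Z} hf hZ := by
    have h1 := mdiff_inner hY hZ
    have h2 := mdiff_inner hZ hX
    simp only [koszul, mlieBracket_smul_right hf hZ, Pi.smul_apply', real_inner_smul_left,
      real_inner_smul_right, inner_add_left, mvfderiv_fun_mul hf h1, mvfderiv_fun_mul hf h2]
    simp [real_inner_comm]
    ring
  add {Z Z'} hZ hZ' := by
    simp only [koszul, mlieBracket_add_right hZ hZ', Pi.add_apply, inner_add_left,
      inner_add_right, mvfderiv_fun_add (mdiff_inner hY hZ) (mdiff_inner hY hZ'),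
      mvfderiv_fun_add (mdiff_inner hZ hX) (mdiff_inner hZ' hX)]
    simp
    ring

theorem koszul_add {X Y Y' Z : Π x : M, TangentSpace I x} {x : M}
    (hX : MDiffAt (T% X) x) (hY : MDiffAt (T% Y) x) (hY' : MDiffAt (T% Y') x)
    (hZ : MDiffAt (T% Z) x) :
    koszul (I := I) X (Y + Y') Z x = koszul X Y Z x + koszul X Y' Z x := by
  simp only [koszul, mlieBracket_add_right hY hY', mlieBracket_add_left hY hY', Pi.add_apply,
    inner_add_left, inner_add_right, mvfderiv_fun_add (mdiff_inner hY hZ) (mdiff_inner hY' hZ),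
    mvfderiv_fun_add (mdiff_inner hX hY) (mdiff_inner hX hY')]
  simp
  ring

theorem koszul_smul {X Y Z : Π x : M, TangentSpace I x} {f : M → ℝ} {x : M}
    (hX : MDiffAt (T% X) x) (hY : MDiffAt (T% Y) x) (hZ : MDiffAt (T% Z) x) (hf : MDiffAt f x) :
    koszul (I := I) X (f • Y) Z x
      = f x * koszul X Y Z x + 2 * (mvfderiv I f x (X x) * inner ℝ (Y x) (Z x)) := by
  have h1 := mdiff_inner hY hZ
  have h2 := mdiff_inner hX hY
  simp only [koszul, mlieBracket_smul_left hf hY, mlieBracket_smul_right hf hY, Pi.smul_apply',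
    real_inner_smul_left, real_inner_smul_right, inner_add_left, mvfderiv_fun_mul hf h1,
    mvfderiv_fun_mul hf h2]
  simp [real_inner_comm]
  ring

/-- The bilinear form `(v, w) ↦ 2 ⟨∇^g_v Y, w⟩` on the tangent space at `x`. -/
def koszulForm (Y : Π x : M, TangentSpace I x) (x : M) (hY : MDiffAt (T% Y) x) :
    TangentSpace I x →L[ℝ] TangentSpace I x →L[ℝ] ℝ :=
  TensorialAt.mkHom₂ (F := E) (F' := E) (I := I) (koszul · Y · x) x
    (fun _ hZ ↦ koszul_tensorial₁ hY hZ) (fun _ hX ↦ koszul_tensorial₃ hX hY)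

open scoped Classical in
/-- `∇^g Y` at `x`, determined by the Koszul formula (and `0` if `Y` is not differentiable). -/
def leviCivitaFun (Y : Π x : M, TangentSpace I x) (x : M) :
    TangentSpace I x →L[ℝ] TangentSpace I x :=
  if hY : MDiffAt (T% Y) x then
    LinearMap.toContinuousLinearMap
      { toFun := fun v ↦ sharp x ((1 / 2 : ℝ) • koszulForm Y x hY v)
        map_add' := fun v w ↦ sharp_eq_of_forall _ _ _ fun u ↦ by
          simp only [inner_add_left, inner_sharp]
          simp
        map_smul' := fun c v ↦ sharp_eq_of_forall _ _ _ fun u ↦ by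
          simp only [inner_smul_left, inner_sharp]
          simp
          ring }
  else 0

theorem two_inner_leviCivitaFun {X Y Z : Π x : M, TangentSpace I x} {x : M}
    (hX : MDiffAt (T% X) x) (hY : MDiffAt (T% Y) x) (hZ : MDiffAt (T% Z) x) :
    2 * inner ℝ (leviCivitaFun Y x (X x)) (Z x) = koszul (I := I) X Y Z x := by
  have h : koszulForm Y x hY (X x) (Z x) = koszul X Y Z x :=
    TensorialAt.mkHom₂_apply _ _ hX hZ
  simp only [leviCivitaFun, dif_pos hY]
  change 2 * inner ℝ (sharp x ((1 / 2 : ℝ) • koszulForm Y x hY (X x))) (Z x) = _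
  rw [inner_sharp, ← h]
  simp

theorem leviCivitaFun_eq {Y : Π x : M, TangentSpace I x} {x : M} (hY : MDiffAt (T% Y) x)
    (L : TangentSpace I x →L[ℝ] TangentSpace I x)
    (h : ∀ X Z : Π x : M, TangentSpace I x, MDiffAt (T% X) x → MDiffAt (T% Z) x →
      2 * inner ℝ (L (X x)) (Z x) = koszul (I := I) X Y Z x) :
    leviCivitaFun Y x = L := by
  ext1 v
  refine ext_inner_right ℝ fun w ↦ ?_
  have hv := FiberBundle.mdifferentiableAt_extend (I := I) E v
  have hw := FiberBundle.mdifferentiableAt_extend (I := I) E w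
  have h1 := two_inner_leviCivitaFun hv hY hw
  have h2 := h _ _ hv hw
  simp only [FiberBundle.extend_apply_self] at h1 h2
  linarith

variable (I M) in
/-- The Levi-Civita connection `∇^g`; `leviCivita I M Y x (X x)` is `∇^g_X Y` at `x`. -/
def leviCivita : CovariantDerivative I E (TangentSpace I : M → Type _) where
  toFun := leviCivitaFun
  isCovariantDerivativeOnUniv :=
    { add := fun {Y Y' x} hY hY' _ ↦ by
        refine leviCivitaFun_eq (mdifferentiableAt_add_section hY hY') _ fun X Z hX hZ ↦ ?_
        rw [koszul_add hX hY hY' hZ, ← two_inner_leviCivitaFun hX hY hZ,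
          ← two_inner_leviCivitaFun hX hY' hZ, _root_.add_apply, inner_add_left]
        ring
      leibniz := fun {Y f x} hY hf _ ↦ by
        refine leviCivitaFun_eq (hf.smul_section hY) _ fun X Z hX hZ ↦ ?_
        rw [koszul_smul hX hY hZ hf, ← two_inner_leviCivitaFun hX hY hZ]
        simp [inner_add_left, inner_smul_left]
        ring }

/-- `∇^g` is torsion-free. -/
theorem leviCivita_torsion : (leviCivita I M).torsion = 0 := by
  rw [CovariantDerivative.torsion_eq_zero_iff]
  intro X Y x hX hY
  refine ext_inner_right ℝ fun w ↦ ?_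
  have hw := FiberBundle.mdifferentiableAt_extend (I := I) E w
  have h1 := two_inner_leviCivitaFun hX hY hw
  have h2 := two_inner_leviCivitaFun hY hX hw
  have h3 : mlieBracket I Y X x = - mlieBracket I X Y x := mlieBracket_swap_apply
  simp only [koszul, FiberBundle.extend_apply_self, h3, inner_neg_left] at h1 h2
  simp only [real_inner_comm] at h1 h2
  change inner ℝ (leviCivitaFun Y x (X x) - leviCivitaFun X x (Y x)) w = _
  rw [inner_sub_left]
  simp only [real_inner_comm]
  linarith

/-- `∇^g` is compatible with the metric. -/
theorem leviCivita_metric {X Y Z : Π x : M, TangentSpace I x} {x : M}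
    (hX : MDiffAt (T% X) x) (hY : MDiffAt (T% Y) x) (hZ : MDiffAt (T% Z) x) :
    mvfderiv I (fun y ↦ (inner ℝ (Y y) (Z y) : ℝ)) x (X x)
      = inner ℝ (leviCivita I M Y x (X x)) (Z x) + inner ℝ (Y x) (leviCivita I M Z x (X x)) := by
  have h1 := two_inner_leviCivitaFun hX hY hZ
  have h2 := two_inner_leviCivitaFun hX hZ hY
  have h3 : mlieBracket I Z Y x = - mlieBracket I Y Z x := mlieBracket_swap_apply
  change _ = inner ℝ (leviCivitaFun Y x (X x)) (Z x) + inner ℝ (Y x) (leviCivitaFun Z x (X x))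
  rw [real_inner_comm _ (Y x)]
  simp only [koszul, h3, inner_neg_left] at h1 h2
  have e1 : (fun y ↦ (inner ℝ (Z y) (Y y) : ℝ)) = fun y ↦ inner ℝ (Y y) (Z y) :=
    funext fun y ↦ real_inner_comm _ _
  have e2 : (fun y ↦ (inner ℝ (Y y) (X y) : ℝ)) = fun y ↦ inner ℝ (X y) (Y y) :=
    funext fun y ↦ real_inner_comm _ _
  have e3 : (fun y ↦ (inner ℝ (Z y) (X y) : ℝ)) = fun y ↦ inner ℝ (X y) (Z y) :=
    funext fun y ↦ real_inner_comm _ _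
  rw [e3] at h1
  rw [e1, e2] at h2
  linarith

end LeviCivita

section ThreeForms

/-- A `3`-form on `M`: an alternating trilinear form on each tangent space. -/
abbrev ThreeForm (I : ModelWithCorners ℝ E H) (M : Type*) [TopologicalSpace M]
    [ChartedSpace H M] : Type _ :=
  Π x : M, TangentSpace I x [⋀^Fin 3]→L[ℝ] ℝ

/-- A `3`-form `T` is smooth if `T(X, Y, Z)` is smooth for all smooth (local) vector fields. -/
def ThreeForm.IsSmooth [IsManifold I ∞ M] (T : ThreeForm I M) : Prop :=
  ∀ (x : M) (X Y Z : Π x : M, TangentSpace I x),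
    CMDiffAt ∞ (T% X) x → CMDiffAt ∞ (T% Y) x → CMDiffAt ∞ (T% Z) x →
      CMDiffAt ∞ (fun y ↦ T y ![X y, Y y, Z y]) x

/-- The function `T(X, Y, Z)` on `M`. -/
def ThreeForm.eval (T : ThreeForm I M) (X Y Z : Π x : M, TangentSpace I x) (x : M) : ℝ :=
  T x ![X x, Y x, Z x]

/-- The exterior derivative `dT(X, Y, Z, W)` at `x`, by the invariant formula
`dT(X₀, …, X₃) = ∑ᵢ (-1)ⁱ Xᵢ(T(…, X̂ᵢ, …)) + ∑_{i<j} (-1)ⁱ⁺ʲ T([Xᵢ, Xⱼ], …, X̂ᵢ, …, X̂ⱼ, …)`. -/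
def ThreeForm.extDeriv (T : ThreeForm I M) (X Y Z W : Π x : M, TangentSpace I x) (x : M) : ℝ :=
  mvfderiv I (T.eval Y Z W) x (X x) - mvfderiv I (T.eval X Z W) x (Y x)
    + mvfderiv I (T.eval X Y W) x (Z x) - mvfderiv I (T.eval X Y Z) x (W x)
    - T.eval (mlieBracket I X Y) Z W x + T.eval (mlieBracket I X Z) Y W x
    - T.eval (mlieBracket I X W) Y Z x - T.eval (mlieBracket I Y Z) X W x
    + T.eval (mlieBracket I Y W) X Z x - T.eval (mlieBracket I Z W) X Y x

/-- The covector `θ(u, v, ·)`. -/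
def contract {x : M} (θ : TangentSpace I x [⋀^Fin 3]→L[ℝ] ℝ) (u v : TangentSpace I x) :
    TangentSpace I x →L[ℝ] ℝ :=
  θ.toContinuousMultilinearMap.toContinuousLinearMap ![u, v, 0] 2

theorem contract_apply {x : M} (θ : TangentSpace I x [⋀^Fin 3]→L[ℝ] ℝ)
    (u v w : TangentSpace I x) : contract θ u v w = θ ![u, v, w] := by
  change θ (Function.update ![u, v, 0] 2 w) = _
  congr 1
  ext i
  fin_cases i <;> rfl

theorem threeForm_add₁ {x : M} (θ : TangentSpace I x [⋀^Fin 3]→L[ℝ] ℝ)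
    (u u' v w : TangentSpace I x) : θ ![u + u', v, w] = θ ![u, v, w] + θ ![u', v, w] :=
  θ.toContinuousMultilinearMap.cons_add ![v, w] u u'

theorem threeForm_smul₁ {x : M} (θ : TangentSpace I x [⋀^Fin 3]→L[ℝ] ℝ) (c : ℝ)
    (u v w : TangentSpace I x) : θ ![c • u, v, w] = c * θ ![u, v, w] :=
  θ.toContinuousMultilinearMap.cons_smul ![v, w] c u

theorem threeForm_swap {x : M} (θ : TangentSpace I x [⋀^Fin 3]→L[ℝ] ℝ)
    (u v w : TangentSpace I x) : θ ![u, v, w] = - θ ![v, u, w] := by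
  refine Eq.trans ?_ (θ.map_swap ![v, u, w] (i := 0) (j := 1) (by decide))
  change θ _ = θ _
  congr 1
  ext i
  fin_cases i <;> rfl

end ThreeForms

section Connection

variable [RiemannianBundle (fun x : M ↦ TangentSpace I x)]

/-- The vector `θ(u, v, ·)^♯`, characterised by `⟨θ(u, v, ·)^♯, w⟩ = θ(u, v, w)`. -/
def sharp₂ {x : M} (θ : TangentSpace I x [⋀^Fin 3]→L[ℝ] ℝ) (u v : TangentSpace I x) :
    TangentSpace I x :=
  sharp x (contract θ u v)

theorem inner_sharp₂ {x : M} (θ : TangentSpace I x [⋀^Fin 3]→L[ℝ] ℝ)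
    (u v w : TangentSpace I x) : inner ℝ (sharp₂ θ u v) w = θ ![u, v, w] := by
  rw [sharp₂, inner_sharp, contract_apply]

/-- The bilinear map `(v, u) ↦ s T(u, v, ·)^♯` on each tangent space. -/
def torsionMap (s : ℝ) (T : ThreeForm I M) (x : M) :
    TangentSpace I x →L[ℝ] TangentSpace I x →L[ℝ] TangentSpace I x :=
  (LinearMap.mk₂ ℝ (fun v u ↦ s • sharp₂ (T x) u v)
    (fun v v' u ↦ ext_inner_right ℝ fun w ↦ by
      simp only [inner_add_left, real_inner_smul_left, inner_sharp₂]
      rw [threeForm_swap, threeForm_add₁, threeForm_swap _ v, threeForm_swap _ v']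
      ring)
    (fun c v u ↦ ext_inner_right ℝ fun w ↦ by
      simp only [real_inner_smul_left, inner_sharp₂]
      rw [threeForm_swap, threeForm_smul₁, threeForm_swap _ v]
      ring)
    (fun v u u' ↦ ext_inner_right ℝ fun w ↦ by
      simp only [inner_add_left, real_inner_smul_left, inner_sharp₂, threeForm_add₁]
      ring)
    (fun c v u ↦ ext_inner_right ℝ fun w ↦ by
      simp only [real_inner_smul_left, inner_sharp₂, threeForm_smul₁]
      ring)).toContinuousBilinearMap

theorem torsionMap_apply (s : ℝ) (T : ThreeForm I M) (x : M) (u v : TangentSpace I x) :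
    torsionMap s T x v u = s • sharp₂ (T x) u v :=
  rfl

variable [IsManifold I ∞ M] [IsContMDiffRiemannianBundle I ∞ E (fun x : M ↦ TangentSpace I x)]

/-- The connection `∇_X Y = ∇^g_X Y + s T(X, Y, ·)^♯`. -/
def torsionConnection (s : ℝ) (T : ThreeForm I M) :
    CovariantDerivative I E (TangentSpace I : M → Type _) :=
  (leviCivita I M).addOneForm (torsionMap s T)

theorem torsionConnection_apply (s : ℝ) (T : ThreeForm I M) (X Y : Π x : M, TangentSpace I x)
    (x : M) : torsionConnection s T Y x (X x)
      = leviCivita I M Y x (X x) + s • sharp₂ (T x) (X x) (Y x) :=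
  rfl

end Connection

section Curvature

variable [IsManifold I ∞ M] (cov : CovariantDerivative I E (TangentSpace I : M → Type _))

/-- The curvature `Riem(X, Y)Z = ∇_X ∇_Y Z - ∇_Y ∇_X Z - ∇_[X, Y] Z` of a connection. -/
def curvature (X Y Z : Π x : M, TangentSpace I x) (x : M) : TangentSpace I x :=
  cov (fun y ↦ cov Z y (Y y)) x (X x) - cov (fun y ↦ cov Z y (X y)) x (Y x)
    - cov Z x (mlieBracket I X Y x)

variable [RiemannianBundle (fun x : M ↦ TangentSpace I x)]

/-- The `(4,0)`-curvature tensor `riem(X, Y, Z, W) = ⟨Riem(X, Y)Z, W⟩`. -/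
def riem (X Y Z W : Π x : M, TangentSpace I x) (x : M) : ℝ :=
  inner ℝ (curvature cov X Y Z x) (W x)

/-- `riem^A`, the part of `riem` antisymmetric under exchange of the two pairs of arguments. -/
def riemAnti (X Y Z W : Π x : M, TangentSpace I x) (x : M) : ℝ :=
  (1 / 2 : ℝ) * (riem cov X Y Z W x - riem cov Z W X Y x)

variable {ι : Type*} [Fintype ι] (e : ι → Π x : M, TangentSpace I x)

/-- The Ricci curvature `ric(X, Y) = tr (V ↦ Riem(V, X)Y)` at `x`, for vector fields `e i` that
form an orthonormal basis at `x`. -/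
def ricci (X Y : Π x : M, TangentSpace I x) (x : M) : ℝ :=
  ∑ i, riem cov (e i) X Y (e i) x

/-- The scalar curvature at `x`, for vector fields `e i` orthonormal at `x`. -/
def scalarCurvature (x : M) : ℝ :=
  ∑ j, ricci cov e (e j) (e j) x

/-- The squared norm at `x` of a `(4,0)`-tensor (given by its action on vector fields): the sum of
the squares of all its components with respect to an orthonormal basis `e i x`. -/
def normSq₄ (F : (X Y Z W : Π x : M, TangentSpace I x) → M → ℝ) (x : M) : ℝ :=
  ∑ i, ∑ j, ∑ k, ∑ l, F (e i) (e j) (e k) (e l) x ^ 2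

/-- The squared norm at `x` of a `3`-form as a `(3,0)`-tensor: the sum of the squares of all its
components (without a factor `1 / 3!`). -/
def normSq₃ (T : ThreeForm I M) (x : M) : ℝ :=
  ∑ i, ∑ j, ∑ k, T x ![e i x, e j x, e k x] ^ 2

variable [IsContMDiffRiemannianBundle I ∞ E (fun x : M ↦ TangentSpace I x)]

/-- `B(T) = ∑_{i,j,k} ric^g(E_i, E_k) ⟨T(E_i, E_j, ·)^♯, T(E_j, E_k, ·)^♯⟩ + ¼ R^g ‖T‖²`. -/
def ricciCoupling (T : ThreeForm I M) (x : M) : ℝ :=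
  (∑ i, ∑ j, ∑ k, ricci (leviCivita I M) e (e i) (e k) x
      * inner ℝ (sharp₂ (T x) (e i x) (e j x)) (sharp₂ (T x) (e j x) (e k x)))
    + (1 / 4 : ℝ) * scalarCurvature (leviCivita I M) e x * normSq₃ e T x

end Curvature

end SkewTorsion

end

noncomputable section

namespace SkewTorsion

set_option linter.unusedSectionVars false

variable {E : Type*} [NormedAddCommGroup E] [NormedSpace ℝ E] [FiniteDimensional ℝ E]
  [CompleteSpace E] {H : Type*} [TopologicalSpace H] {I : ModelWithCorners ℝ E H}
  {M : Type*} [TopologicalSpace M] [ChartedSpace H M]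

/-! ### Pointwise tensor algebra in dimension four. -/

section Algebra

/-! The curvature of `∇` is `riem^g`, plus `s` times the part of `∇^g T` skew in the first two
arguments, plus `s² Q` with `Q` quadratic in `T` (`riem_torsionConnection`). Exchanging the two
pairs of arguments is an isometry, so `‖Riem‖²` is `‖riem^A‖²` plus the squared norm of the
pair-symmetric part (`sum_sq_eq_add_sum_antisymm_sq`). In that part `riem^g` and `Q` survive
unchanged, while the derivative terms collapse to `½ s dT`.

It remains to expand `‖riem^g + ½ s dT + s² Q‖²`. The first Bianchi identity gives `⟨riem^g, dT⟩ =
0`. Dimension four controls `Q`: there `T = ⋆v`, so in an orthonormal basis adapted to `v` the only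
component of `T` up to permutation is `T₁₂₃ = c`, and `Q` is `c²(δ_ik δ_jl - δ_il δ_jk)` on the
hyperplane `v^⊥`. Hence `‖Q‖² = 12c⁴ = ⅓‖T‖⁴`; `Q ⟂ dT`, because four distinct indices do not fit
into a three-dimensional space; and `⟨riem^g, Q⟩` is `-2c²` times the scalar trace of `riem^g` over
`v^⊥`, which produces the `B(T)` and `R^g‖T‖²` terms. The formal proof verifies these as polynomial
identities in the four components of `T`, in any basis.

The analytic half proves the curvature symmetries and the formula for `riem` using vector fields
that are smooth at `p` but orthonormal only at `p` itself. -/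

theorem sum_pairs_fin_four {G : Fin 4 → Fin 4 → ℝ} (h : ∀ i j, G i j = G j i)
    (h0 : ∀ i, G i i = 0) :
    ∑ i, ∑ j, G i j = 2 * (G 0 1 + G 0 2 + G 0 3 + G 1 2 + G 1 3 + G 2 3) := by
  simp only [Fin.sum_univ_four, h0, h 1 0, h 2 0, h 3 0, h 2 1, h 3 1, h 3 2]
  ring

/-- The components of the alternating trilinear form `⋆v` on a four-dimensional space. -/
def hodge (a b c d : ℝ) : Fin 4 → Fin 4 → Fin 4 → ℝ :=
  ![![![0, 0, 0, 0], ![0, 0, a, b], ![0, -a, 0, c], ![0, -b, -c, 0]],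
    ![![0, 0, -a, -b], ![0, 0, 0, 0], ![a, 0, 0, d], ![b, 0, -d, 0]],
    ![![0, a, 0, -c], ![-a, 0, 0, -d], ![0, 0, 0, 0], ![c, d, 0, 0]],
    ![![0, b, c, 0], ![-b, 0, d, 0], ![-c, -d, 0, 0], ![0, 0, 0, 0]]]

/-- The space of 3-forms in dimension four is itself four-dimensional; the parameters are the
components with increasing indices. -/
theorem exists_eq_hodge {t : Fin 4 → Fin 4 → Fin 4 → ℝ} (h₁ : ∀ i j k, t i j k = -t j i k)
    (h₂ : ∀ i j k, t i j k = -t i k j) : ∃ a b c d, t = hodge a b c d := by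
  have z₁ : ∀ i k, t i i k = 0 := fun i k ↦ by linarith [h₁ i i k]
  have z₂ : ∀ i k, t i k k = 0 := fun i k ↦ by linarith [h₂ i k k]
  have z₃ : ∀ i k, t i k i = 0 := fun i k ↦ by linarith [h₂ i k i, z₁ i k]
  refine ⟨t 0 1 2, t 0 1 3, t 0 2 3, t 1 2 3, ?_⟩
  have key : ∀ i j k, t i j k = -t i k j ∧ t i j k = -t j i k ∧ t i j k = t j k i ∧
      t i j k = t k i j ∧ t i j k = -t k j i := fun i j k ↦ by
    refine ⟨h₂ i j k, h₁ i j k, ?_, ?_, ?_⟩ <;>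
      linarith [h₁ i j k, h₂ j i k, h₂ i j k, h₁ i k j, h₁ j k i, h₂ k i j, h₁ k j i]
  obtain ⟨p1, p2, p3, p4, p5⟩ := key 0 1 2
  obtain ⟨q1, q2, q3, q4, q5⟩ := key 0 1 3
  obtain ⟨r1, r2, r3, r4, r5⟩ := key 0 2 3
  obtain ⟨s1, s2, s3, s4, s5⟩ := key 1 2 3
  funext i j k
  fin_cases i <;> fin_cases j <;> fin_cases k <;>
    simp only [hodge, Fin.zero_eta, Fin.mk_one, Fin.reduceFinMk, Fin.isValue, z₁, z₂, z₃,
      Matrix.cons_val] <;> linarith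

/-- The quadratic expression in a `3`-form that enters the curvature of a skew-torsion
connection. -/
def quadCurv (t : Fin 4 → Fin 4 → Fin 4 → ℝ) (i j k l : Fin 4) : ℝ :=
  (∑ m, t j l m * t i k m) - ∑ m, t i l m * t j k m

/-- On `v^⊥` the tensor is of constant-curvature type, with twelve entries `±c²`, while the 3-form
has six entries `±c`; this explains the factor 1/3. -/
theorem sum_quadCurv_sq (a b c d : ℝ) :
    ∑ i, ∑ j, ∑ k, ∑ l, quadCurv (hodge a b c d) i j k l ^ 2
      = 1 / 3 * (∑ i, ∑ j, ∑ k, hodge a b c d i j k ^ 2) ^ 2 := by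
  simp only [quadCurv, Fin.sum_univ_four, hodge, Matrix.cons_val]
  ring

/-- The pairing sees only the total antisymmetrisation of `quadCurv`, a 4-form supported on the
three-dimensional space `v^⊥`, hence zero. -/
theorem sum_alternating_mul_quadCurv (a b c d : ℝ) {w : Fin 4 → Fin 4 → Fin 4 → Fin 4 → ℝ}
    (h₁ : ∀ i j k l, w i j k l = -w j i k l) (h₂ : ∀ i j k l, w i j k l = -w i k j l)
    (h₃ : ∀ i j k l, w i j k l = -w i j l k) :
    ∑ i, ∑ j, ∑ k, ∑ l, w i j k l * quadCurv (hodge a b c d) i j k l = 0 := by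
  have q₁ : ∀ i j k l, quadCurv (hodge a b c d) i j k l = -quadCurv (hodge a b c d) j i k l :=
    fun i j k l ↦ by unfold quadCurv; ring
  have z₁ : ∀ i k l, w i i k l = 0 := fun i k l ↦ by linarith [h₁ i i k l]
  have z₂ : ∀ i k l, w i k k l = 0 := fun i k l ↦ by linarith [h₂ i k k l]
  have z₃ : ∀ i k l, w i k l l = 0 := fun i k l ↦ by linarith [h₃ i k l l]
  have z₄ : ∀ i k l, w i k i l = 0 := fun i k l ↦ by linarith [h₂ i k i l, z₁ i k l]
  have z₅ : ∀ i k l, w i k l k = 0 := fun i k l ↦ by linarith [h₃ i k l k, z₂ i k l]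
  have z₆ : ∀ i k l, w i k l i = 0 := fun i k l ↦ by linarith [h₃ i k l i, z₄ i k l]
  rw [sum_pairs_fin_four (fun i j ↦ by simp only [h₁ i j, q₁ i j, neg_mul_neg])
    (fun i ↦ by simp [z₁])]
  simp only [Fin.sum_univ_four, z₂, z₃, z₄, z₅, z₆, zero_mul, add_zero, zero_add]
  simp only [quadCurv, Fin.sum_univ_four, hodge, Matrix.cons_val]
  -- Only components with distinct indices remain. Each is sorted to `± w 0 1 2 3`, whose total
  -- coefficient then cancels.
  rw [h₃ 0 1 3 2, h₂ 0 2 1 3, h₃ 0 2 3 1, h₂ 0 2 1 3, h₂ 0 3 1 2, h₃ 0 1 3 2,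
    h₃ 0 3 2 1, h₂ 0 3 1 2, h₃ 0 1 3 2, h₂ 1 2 0 3, h₁ 1 0 2 3, h₃ 1 2 3 0, h₂ 1 2 0 3, h₁ 1 0 2 3,
    h₂ 1 3 0 2, h₃ 1 0 3 2, h₁ 1 0 2 3, h₃ 1 3 2 0, h₂ 1 3 0 2, h₃ 1 0 3 2, h₁ 1 0 2 3,
    h₃ 2 3 1 0, h₂ 2 3 0 1, h₁ 2 0 3 1, h₃ 0 2 3 1, h₂ 0 2 1 3]
  ring

/-- A cyclic permutation of three slots is even, so it fixes `w`; averaging the sum over the three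
rotations replaces `r` by its Bianchi sum. -/
theorem sum_mul_alternating {r w : Fin 4 → Fin 4 → Fin 4 → Fin 4 → ℝ}
    (hb : ∀ i j k l, r i j k l + r j k i l + r k i j l = 0)
    (h₁ : ∀ i j k l, w i j k l = -w j i k l) (h₂ : ∀ i j k l, w i j k l = -w i k j l) :
    ∑ i, ∑ j, ∑ k, ∑ l, r i j k l * w i j k l = 0 := by
  have e₁ : ∑ i, ∑ j, ∑ k, ∑ l, r i j k l * w i j k l
      = ∑ i, ∑ j, ∑ k, ∑ l, r j k i l * w i j k l := by
    calc _ = ∑ j, ∑ k, ∑ i, ∑ l, r j k i l * w j k i l := rfl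
      _ = ∑ j, ∑ i, ∑ k, ∑ l, r j k i l * w j k i l :=
        Finset.sum_congr rfl fun _ _ ↦ Finset.sum_comm
      _ = ∑ i, ∑ j, ∑ k, ∑ l, r j k i l * w j k i l := Finset.sum_comm
      _ = _ := by
        refine Finset.sum_congr rfl fun i _ ↦ Finset.sum_congr rfl fun j _ ↦
          Finset.sum_congr rfl fun k _ ↦ Finset.sum_congr rfl fun l _ ↦ ?_
        rw [h₂ j k i l, h₁ j i k l, neg_neg]
  have e₂ : ∑ i, ∑ j, ∑ k, ∑ l, r i j k l * w i j k l
      = ∑ i, ∑ j, ∑ k, ∑ l, r k i j l * w i j k l := by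
    calc _ = ∑ k, ∑ i, ∑ j, ∑ l, r k i j l * w k i j l := rfl
      _ = ∑ i, ∑ k, ∑ j, ∑ l, r k i j l * w k i j l := Finset.sum_comm
      _ = ∑ i, ∑ j, ∑ k, ∑ l, r k i j l * w k i j l :=
        Finset.sum_congr rfl fun _ _ ↦ Finset.sum_comm
      _ = _ := by
        refine Finset.sum_congr rfl fun i _ ↦ Finset.sum_congr rfl fun j _ ↦
          Finset.sum_congr rfl fun k _ ↦ Finset.sum_congr rfl fun l _ ↦ ?_
        rw [h₁ k i j l, h₂ i k j l, neg_neg]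
  have e₃ : ∑ i, ∑ j, ∑ k, ∑ l, (r i j k l + r j k i l + r k i j l) * w i j k l = 0 := by
    simp only [hb, zero_mul, Finset.sum_const_zero]
  simp only [add_mul, Finset.sum_add_distrib] at e₃
  linarith

/-- Both sides equal `-2c²(R - 2 ric(v, v))` for a unit `v` and a 3-form of size `c` on `v^⊥`. Only
the skewness of `r` in each pair matters; the right side is grouped to match `B(T)`. -/
theorem sum_mul_quadCurv (a b c d : ℝ) {r : Fin 4 → Fin 4 → Fin 4 → Fin 4 → ℝ}
    (h₁ : ∀ i j k l, r i j k l = -r j i k l) (h₂ : ∀ i j k l, r i j k l = -r i j l k) :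
    ∑ i, ∑ j, ∑ k, ∑ l, r i j k l * quadCurv (hodge a b c d) i j k l
      = 2 * ((∑ i, ∑ j, ∑ k, (∑ n, r n i k n)
          * ∑ m, hodge a b c d i j m * hodge a b c d j k m)
        + 1 / 4 * (∑ j, ∑ i, r i j j i) * ∑ i, ∑ j, ∑ k, hodge a b c d i j k ^ 2)
        - 1 / 6 * (∑ j, ∑ i, r i j j i) * ∑ i, ∑ j, ∑ k, hodge a b c d i j k ^ 2 := by
  have q₁ : ∀ i j k l, quadCurv (hodge a b c d) i j k l = -quadCurv (hodge a b c d) j i k l :=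
    fun i j k l ↦ by unfold quadCurv; ring
  have q₂ : ∀ i j k l, quadCurv (hodge a b c d) i j k l = -quadCurv (hodge a b c d) i j l k :=
    fun i j k l ↦ by simp only [quadCurv, mul_comm]; ring
  have z₁ : ∀ i k l, r i i k l = 0 := fun i k l ↦ by linarith [h₁ i i k l]
  have z₂ : ∀ i k l, r i k l l = 0 := fun i k l ↦ by linarith [h₂ i k l l]
  rw [sum_pairs_fin_four (fun i j ↦ by simp only [h₁ i j, q₁ i j, neg_mul_neg])
    (fun i ↦ by simp [z₁])]
  have e : ∀ i j, ∑ k, ∑ l, r i j k l * quadCurv (hodge a b c d) i j k l = _ := fun i j ↦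
    sum_pairs_fin_four (fun k l ↦ by rw [h₂ i j k l, q₂ i j k l, neg_mul_neg])
    (fun k ↦ by simp [z₂])
  simp only [e]
  simp only [quadCurv, Fin.sum_univ_four, hodge, Matrix.cons_val, z₁, z₂,
    h₁ 1 0, h₁ 2 0, h₁ 3 0, h₁ 2 1, h₁ 3 1, h₁ 3 2, h₂ _ _ 1 0, h₂ _ _ 2 0, h₂ _ _ 3 0,
    h₂ _ _ 2 1, h₂ _ _ 3 1, h₂ _ _ 3 2]
  ring

/-- Pythagoras for the splitting of `F` under the pair exchange, which preserves the norm. -/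
theorem sum_sq_eq_add_sum_antisymm_sq (F S : Fin 4 → Fin 4 → Fin 4 → Fin 4 → ℝ)
    (h : ∀ i j k l, S i j k l = 1 / 2 * (F i j k l + F k l i j)) :
    ∑ i, ∑ j, ∑ k, ∑ l, F i j k l ^ 2
      = (∑ i, ∑ j, ∑ k, ∑ l, S i j k l ^ 2)
        + ∑ i, ∑ j, ∑ k, ∑ l, ((1 / 2 : ℝ) * (F i j k l - F k l i j)) ^ 2 := by
  have e : ∑ i, ∑ j, ∑ k, ∑ l, F i j k l ^ 2 = ∑ i, ∑ j, ∑ k, ∑ l, F k l i j ^ 2 := by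
    calc _ = ∑ k, ∑ l, ∑ i, ∑ j, F k l i j ^ 2 := rfl
      _ = ∑ k, ∑ i, ∑ l, ∑ j, F k l i j ^ 2 := Finset.sum_congr rfl fun _ _ ↦ Finset.sum_comm
      _ = ∑ i, ∑ k, ∑ l, ∑ j, F k l i j ^ 2 := Finset.sum_comm
      _ = ∑ i, ∑ k, ∑ j, ∑ l, F k l i j ^ 2 := Finset.sum_congr rfl fun _ _ ↦
        Finset.sum_congr rfl fun _ _ ↦ Finset.sum_comm
      _ = _ := Finset.sum_congr rfl fun _ _ ↦ Finset.sum_comm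
  have e' : (∑ i, ∑ j, ∑ k, ∑ l, S i j k l ^ 2)
        + ∑ i, ∑ j, ∑ k, ∑ l, ((1 / 2 : ℝ) * (F i j k l - F k l i j)) ^ 2
      = ∑ i, ∑ j, ∑ k, ∑ l, (1 / 2 * F i j k l ^ 2 + 1 / 2 * F k l i j ^ 2) := by
    simp only [← Finset.sum_add_distrib]
    refine Finset.sum_congr rfl fun i _ ↦ Finset.sum_congr rfl fun j _ ↦
      Finset.sum_congr rfl fun k _ ↦ Finset.sum_congr rfl fun l _ ↦ ?_
    rw [h]
    ring
  rw [e']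
  simp only [Finset.sum_add_distrib, ← Finset.mul_sum]
  linarith

/-- The pointwise form of the norm identity: `r` is an algebraic curvature tensor, `t` a `3`-form,
`D i j k l` its covariant derivative, and `F` the curvature of the skew-torsion connection. -/
theorem sum_sq_curvature {s : ℝ} {r D F w : Fin 4 → Fin 4 → Fin 4 → Fin 4 → ℝ}
    {t : Fin 4 → Fin 4 → Fin 4 → ℝ}
    (r₁ : ∀ i j k l, r i j k l = -r j i k l) (r₂ : ∀ i j k l, r i j k l = -r i j l k)
    (rb : ∀ i j k l, r i j k l + r j k i l + r k i j l = 0)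
    (t₁ : ∀ i j k, t i j k = -t j i k) (t₂ : ∀ i j k, t i j k = -t i k j)
    (D₁ : ∀ i j k l, D i j k l = -D i k j l) (D₂ : ∀ i j k l, D i j k l = -D i j l k)
    (hw : ∀ i j k l, w i j k l = D i j k l - D j i k l + D k i j l - D l i j k)
    (hF : ∀ i j k l, F i j k l = r i j k l + s * (D i j k l - D j i k l)
      + s ^ 2 * quadCurv t i j k l) :
    ∑ i, ∑ j, ∑ k, ∑ l, F i j k l ^ 2
      = (∑ i, ∑ j, ∑ k, ∑ l, r i j k l ^ 2)
        + 1 / 3 * s ^ 4 * (∑ i, ∑ j, ∑ k, t i j k ^ 2) ^ 2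
        + 1 / 4 * s ^ 2 * (∑ i, ∑ j, ∑ k, ∑ l, w i j k l ^ 2)
        - 1 / 3 * s ^ 2 * (∑ j, ∑ i, r i j j i) * (∑ i, ∑ j, ∑ k, t i j k ^ 2)
        + 4 * s ^ 2 * ((∑ i, ∑ j, ∑ k, (∑ n, r n i k n) * ∑ m, t i j m * t j k m)
          + 1 / 4 * (∑ j, ∑ i, r i j j i) * ∑ i, ∑ j, ∑ k, t i j k ^ 2)
        + ∑ i, ∑ j, ∑ k, ∑ l, ((1 / 2 : ℝ) * (F i j k l - F k l i j)) ^ 2 := by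
  have w₁ : ∀ i j k l, w i j k l = -w j i k l := fun i j k l ↦ by
    rw [hw, hw, D₁ k i j l, D₁ l i j k]; ring
  have w₂ : ∀ i j k l, w i j k l = -w i k j l := fun i j k l ↦ by
    rw [hw, hw, D₁ i j k l, D₂ l i j k]; ring
  have w₃ : ∀ i j k l, w i j k l = -w i j l k := fun i j k l ↦ by
    rw [hw, hw, D₂ i j k l, D₂ j i k l]; ring
  -- The classical octahedron argument: four Bianchi identities combined with skewness in each pair.
  have rs : ∀ i j k l, r i j k l = r k l i j := fun i j k l ↦ by
    linarith [rb i j k l, rb j k l i, rb k l i j, rb l i j k, r₂ i j k l, r₁ j l i k, r₂ j l i k,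
      r₂ j k i l, r₂ k i j l, r₁ k l i j, r₂ k l i j, r₁ l i j k, r₂ l i j k, r₁ k i l j,
      r₁ i j k l, r₁ i k l j, r₂ i k j l, r₂ j k l i, r₁ l j i k, r₁ i k j l, r₁ l j k i]
  obtain ⟨a, b, c, d, rfl⟩ := exists_eq_hodge t₁ t₂
  -- The pair-symmetric part of `F`: `r` and `quadCurv` are already symmetric, and the four `D`
  -- terms add up to `w`.
  have hS := sum_sq_eq_add_sum_antisymm_sq F
    (fun i j k l ↦ r i j k l + 1 / 2 * s * w i j k l + s ^ 2 * quadCurv (hodge a b c d) i j k l)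
    (fun i j k l ↦ by
      have q : quadCurv (hodge a b c d) k l i j = quadCurv (hodge a b c d) i j k l := by
        have p : ∀ i j m, hodge a b c d i j m = -hodge a b c d j i m := t₁
        unfold quadCurv
        simp only [p l j, p k i, p k j, p l i, neg_mul_neg]
        congr 1
        exact Finset.sum_congr rfl fun _ _ ↦ mul_comm _ _
      rw [hF, hF, q, rs k l i j, hw, D₁ k l i j, D₂ k i l j, D₁ l k i j, D₂ l i k j]
      ring)
  rw [hS]
  have expand : ∑ i, ∑ j, ∑ k, ∑ l, (r i j k l + 1 / 2 * s * w i j k l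
        + s ^ 2 * quadCurv (hodge a b c d) i j k l) ^ 2
      = (∑ i, ∑ j, ∑ k, ∑ l, r i j k l ^ 2)
        + s * (∑ i, ∑ j, ∑ k, ∑ l, r i j k l * w i j k l)
        + 1 / 4 * s ^ 2 * (∑ i, ∑ j, ∑ k, ∑ l, w i j k l ^ 2)
        + 2 * s ^ 2 * (∑ i, ∑ j, ∑ k, ∑ l, r i j k l * quadCurv (hodge a b c d) i j k l)
        + s ^ 3 * (∑ i, ∑ j, ∑ k, ∑ l, w i j k l * quadCurv (hodge a b c d) i j k l)
        + s ^ 4 * (∑ i, ∑ j, ∑ k, ∑ l, quadCurv (hodge a b c d) i j k l ^ 2) := by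
    simp only [Finset.mul_sum, ← Finset.sum_add_distrib]
    refine Finset.sum_congr rfl fun i _ ↦ Finset.sum_congr rfl fun j _ ↦
      Finset.sum_congr rfl fun k _ ↦ Finset.sum_congr rfl fun l _ ↦ ?_
    ring
  rw [expand, sum_mul_alternating rb w₁ w₂, sum_alternating_mul_quadCurv a b c d w₁ w₂ w₃,
    sum_quadCurv_sq, sum_mul_quadCurv a b c d r₁ r₂]
  ring

end Algebra

/-! ### Lie brackets, derivatives along fields, and smooth frames. -/

section Calculus

variable [IsManifold I ∞ M] {X Y Z : Π x : M, TangentSpace I x} {f : M → ℝ} {p : M}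

theorem contMDiffAt_mlieBracket (hX : CMDiffAt ∞ (T% X) p) (hY : CMDiffAt ∞ (T% Y) p) :
    CMDiffAt ∞ (T% (mlieBracket I X Y)) p := by
  have : IsManifold I (((⊤ : ℕ∞) : ℕ∞ω) + 1) M := ‹IsManifold I ∞ M›
  have : IsManifold I (minSmoothness ℝ 2) M := IsManifold.of_le (n := ∞) (by simp [ENat.LEInfty.out])
  exact ContMDiffAt.mlieBracket_vectorField (m := ⊤) (n := ⊤) hX hY (by simp)

theorem eventually_mdifferentiableAt_section (hX : CMDiffAt ∞ (T% X) p) :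
    ∀ᶠ y in nhds p, MDiffAt (T% X) y := by
  have := (contMDiffAt_iff_contMDiffAt_nhds (by simp)).1 (hX.of_le (m := 1) (by simp))
  exact this.mono fun y hy ↦ hy.mdifferentiableAt one_ne_zero

theorem eventually_mdifferentiableAt (hf : CMDiffAt ∞ f p) :
    ∀ᶠ y in nhds p, MDiffAt f y := by
  have := (contMDiffAt_iff_contMDiffAt_nhds (by simp)).1 (hf.of_le (m := 1) (by simp))
  exact this.mono fun y hy ↦ hy.mdifferentiableAt one_ne_zero

theorem mlieBracket_smul_eventuallyEq (hf : CMDiffAt ∞ f p) (hZ : CMDiffAt ∞ (T% Z) p) :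
    mlieBracket I X (f • Z)
      =ᶠ[nhds p] (fun y ↦ mvfderiv I f y (X y)) • Z + f • mlieBracket I X Z := by
  filter_upwards [eventually_mdifferentiableAt hf, eventually_mdifferentiableAt_section hZ]
    with y h1 h2
  exact mlieBracket_smul_right h1 h2

theorem contMDiffAt_smul_section (hf : CMDiffAt ∞ f p) (hZ : CMDiffAt ∞ (T% Z) p) :
    CMDiffAt ∞ (T% (f • Z)) p :=
  hf.smul_section hZ

variable [RiemannianBundle (fun x : M ↦ TangentSpace I x)]
  [IsContMDiffRiemannianBundle I ∞ E (fun x : M ↦ TangentSpace I x)]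

theorem contMDiffAt_inner (hX : CMDiffAt ∞ (T% X) p) (hY : CMDiffAt ∞ (T% Y) p) :
    CMDiffAt ∞ (fun y ↦ (inner ℝ (X y) (Y y) : ℝ)) p :=
  ContMDiffAt.inner_bundle hX hY

/-- The derivative of a smooth function along a smooth vector field is smooth. -/
theorem contMDiffAt_mvfderiv (hf : CMDiffAt ∞ f p) (hX : CMDiffAt ∞ (T% X) p)
    (hZ : CMDiffAt ∞ (T% Z) p) (hp : Z p ≠ 0) :
    CMDiffAt ∞ (fun y ↦ mvfderiv I f y (X y)) p := by
  have hN := contMDiffAt_inner hZ hZ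
  have hN0 : (inner ℝ (Z p) (Z p) : ℝ) ≠ 0 := by simpa using hp
  have h1 := contMDiffAt_inner (contMDiffAt_mlieBracket hX (contMDiffAt_smul_section hf hZ)) hZ
  have h2 := contMDiffAt_inner (contMDiffAt_mlieBracket hX hZ) hZ
  -- Since `[X, fZ] = (Xf) Z + f [X, Z]`, pairing with `Z` and dividing by `|Z|²` recovers `Xf` from
  -- brackets, which are smooth.
  refine ((h1.sub (hf.mul h2)).mul (hN.inv₀ hN0)).congr_of_eventuallyEq ?_
  filter_upwards [mlieBracket_smul_eventuallyEq (X := X) hf hZ,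
    hN.continuousAt.eventually_ne hN0] with y hy hy0
  simp only [Pi.mul_apply, hy, Pi.add_apply, Pi.smul_apply',
    inner_add_left, real_inner_smul_left]
  field_simp
  ring

/-- `[X, Y] f = X (Y f) - Y (X f)`. -/
theorem mvfderiv_mlieBracket (hf : CMDiffAt ∞ f p) (hX : CMDiffAt ∞ (T% X) p)
    (hY : CMDiffAt ∞ (T% Y) p) (hZ : CMDiffAt ∞ (T% Z) p) (hp : Z p ≠ 0) :
    mvfderiv I f p (mlieBracket I X Y p)
      = mvfderiv I (fun y ↦ mvfderiv I f y (Y y)) p (X p)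
        - mvfderiv I (fun y ↦ mvfderiv I f y (X y)) p (Y p) := by
  have md : ∀ {g : M → ℝ}, CMDiffAt ∞ g p → MDiffAt g p := fun h ↦
    h.mdifferentiableAt (by simp)
  have mds : ∀ {W : Π x : M, TangentSpace I x}, CMDiffAt ∞ (T% W) p → MDiffAt (T% W) p := fun h ↦
    h.mdifferentiableAt (by simp)
  have c2 : ∀ {W : Π x : M, TangentSpace I x}, CMDiffAt ∞ (T% W) p →
      CMDiffAt (minSmoothness ℝ 2) (T% W) p := fun h ↦ h.of_le (by simp [ENat.LEInfty.out])
  have : IsManifold I (minSmoothness ℝ 3) M := IsManifold.of_le (n := ∞) (by simp [ENat.LEInfty.out])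
  have second : ∀ {U V : Π x : M, TangentSpace I x}, CMDiffAt ∞ (T% U) p → CMDiffAt ∞ (T% V) p →
      mlieBracket I U (mlieBracket I V (f • Z)) p
        = mvfderiv I (fun y ↦ mvfderiv I f y (V y)) p (U p) • Z p
          + mvfderiv I f p (V p) • mlieBracket I U Z p + mvfderiv I f p (U p) • mlieBracket I V Z p
          + f p • mlieBracket I U (mlieBracket I V Z) p := by
    intro U V hU hV
    have hVf := contMDiffAt_mvfderiv hf hV hZ hp
    have hVZ := contMDiffAt_mlieBracket hV hZ
    have h := (Filter.EventuallyEq.refl (nhds p) U).mlieBracket_vectorField_eq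
      (mlieBracket_smul_eventuallyEq (X := V) hf hZ)
    rw [h, mlieBracket_add_right (mds (contMDiffAt_smul_section hVf hZ))
      (mds (contMDiffAt_smul_section hf hVZ)), mlieBracket_smul_right (md hVf) (mds hZ),
      mlieBracket_smul_right (md hf) (mds hVZ)]
    abel
  -- Compare the Jacobi identity for `X, Y, fZ` with `f` times the one for `X, Y, Z`: the remainder
  -- is the desired scalar identity times `Z p ≠ 0`.
  have j1 := leibniz_identity_mlieBracket_apply (c2 hX) (c2 hY)
    (c2 (contMDiffAt_smul_section hf hZ))
  have j2 := leibniz_identity_mlieBracket_apply (c2 hX) (c2 hY) (c2 hZ)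
  rw [second hX hY, second hY hX, mlieBracket_smul_right (md hf) (mds hZ), j2] at j1
  have j3 : (mvfderiv I f p (mlieBracket I X Y p)
      - (mvfderiv I (fun y ↦ mvfderiv I f y (Y y)) p (X p)
        - mvfderiv I (fun y ↦ mvfderiv I f y (X y)) p (Y p))) • Z p = 0 := by
    rw [← sub_eq_zero] at j1
    rw [← neg_eq_zero, ← j1]
    module
  exact sub_eq_zero.mp ((smul_eq_zero.mp j3).resolve_right hp)

variable {ι : Type*} [Fintype ι] {e : ι → Π x : M, TangentSpace I x}

/-- A vector field is smooth as soon as its inner products with a smooth frame are. -/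
theorem contMDiffAt_section_of_inner (he : ∀ i, CMDiffAt ∞ (T% (e i)) p)
    (hon : Orthonormal ℝ (fun i ↦ e i p)) (hcard : Fintype.card ι = Module.finrank ℝ E)
    (hX : ∀ i, CMDiffAt ∞ (fun y ↦ (inner ℝ (X y) (e i y) : ℝ)) p) : CMDiffAt ∞ (T% X) p := by
  classical
  -- The Gram matrix is the identity at `p`, hence invertible nearby; Cramer's rule then expresses
  -- the coefficients of `X` in the frame as smooth functions.
  let G : M → Matrix ι ι ℝ := fun y ↦ Matrix.of fun i j ↦ inner ℝ (e j y) (e i y)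
  let b : M → ι → ℝ := fun y i ↦ inner ℝ (X y) (e i y)
  have det_smooth : ∀ A : M → Matrix ι ι ℝ, (∀ i j, CMDiffAt ∞ (fun y ↦ A y i j) p) →
      CMDiffAt ∞ (fun y ↦ (A y).det) p := by
    intro A hA
    simp only [Matrix.det_apply']
    refine contMDiffAt_finsetSum fun σ _ ↦ contMDiffAt_const.mul ?_
    exact contMDiffAt_finsetProd fun i _ ↦ hA _ _
  have hG : ∀ i j, CMDiffAt ∞ (fun y ↦ G y i j) p := fun i j ↦ contMDiffAt_inner (he j) (he i)
  have hdet := det_smooth G hG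
  have hdet0 : (G p).det ≠ 0 := by
    have : G p = 1 := by
      ext i j
      simp only [G, Matrix.of_apply, orthonormal_iff_ite.mp hon, Matrix.one_apply, eq_comm]
    simp [this]
  have hcr : ∀ i, CMDiffAt ∞ (fun y ↦ (G y).cramer (b y) i) p := by
    intro i
    simp only [Matrix.cramer_apply]
    refine det_smooth _ fun k l ↦ ?_
    by_cases hl : l = i
    · subst hl
      simpa [Matrix.updateCol_apply] using hX k
    · simpa [Matrix.updateCol_apply, hl] using hG k l
  have hsum : CMDiffAt ∞ (T% (fun y ↦ ∑ i, ((G y).det⁻¹ * (G y).cramer (b y) i) • e i y)) p :=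
    .sum_section fun i _ ↦ ((hdet.inv₀ hdet0).mul (hcr i)).smul_section (he i)
  refine hsum.congr_of_eventuallyEq ?_
  filter_upwards [hdet.continuousAt.eventually_ne hdet0] with y hy
  have hli : LinearIndependent ℝ (fun i ↦ e i y) := by
    rw [Fintype.linearIndependent_iff]
    intro g hg
    have : (G y).mulVec g = 0 := by
      ext i
      have := congrArg (fun v ↦ (inner ℝ v (e i y) : ℝ)) hg
      simpa [sum_inner, real_inner_smul_left, G, Matrix.mulVec, dotProduct, mul_comm] using this
    exact fun i ↦ congrFun (Matrix.eq_zero_of_mulVec_eq_zero hy this) i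
  have hspan := hli.span_eq_top_of_card_eq_finrank' hcard
  congr 1
  refine ext_inner_right ℝ fun w ↦ ?_
  have hw : w ∈ Submodule.span ℝ (Set.range fun i ↦ e i y) := hspan ▸ Submodule.mem_top
  induction hw using Submodule.span_induction with
  | mem x hx =>
    obtain ⟨k, rfl⟩ := hx
    have h := congrFun (Matrix.mulVec_cramer (G y) (b y)) k
    have h' : ∑ i, inner ℝ (e i y) (e k y) * (G y).cramer (b y) i
        = (G y).det * inner ℝ (X y) (e k y) := h
    simp only [sum_inner, real_inner_smul_left, mul_assoc, ← Finset.mul_sum]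
    rw [eq_inv_mul_iff_mul_eq₀ hy, ← h']
    exact Finset.sum_congr rfl fun i _ ↦ mul_comm _ _
  | zero => simp
  | add u v _ _ hu hv => rw [inner_add_right, inner_add_right, hu, hv]
  | smul c u _ hu => rw [real_inner_smul_right, real_inner_smul_right, hu]

end Calculus

/-! ### Multilinearity and skewness of 3-forms. -/

section ThreeFormAlgebra

variable {x : M} (θ : TangentSpace I x [⋀^Fin 3]→L[ℝ] ℝ)

theorem threeForm_swap₂ (u v w : TangentSpace I x) : θ ![u, v, w] = -θ ![u, w, v] := by
  refine Eq.trans ?_ (θ.map_swap ![u, w, v] (i := 1) (j := 2) (by decide))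
  change θ _ = θ _
  congr 1
  ext i
  fin_cases i <;> rfl

theorem threeForm_sub₁ (u u' v w : TangentSpace I x) :
    θ ![u - u', v, w] = θ ![u, v, w] - θ ![u', v, w] := by
  rw [sub_eq_add_neg, ← neg_one_smul ℝ u', threeForm_add₁, threeForm_smul₁]
  ring

theorem threeForm_add₂ (u v v' w : TangentSpace I x) :
    θ ![u, v + v', w] = θ ![u, v, w] + θ ![u, v', w] := by
  rw [threeForm_swap, threeForm_add₁, threeForm_swap θ v, threeForm_swap θ v']
  ring

theorem threeForm_smul₂ (c : ℝ) (u v w : TangentSpace I x) :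
    θ ![u, c • v, w] = c * θ ![u, v, w] := by
  rw [threeForm_swap, threeForm_smul₁, threeForm_swap θ v]
  ring

end ThreeFormAlgebra

/-! ### Smoothness of covariant derivatives. -/

section Smoothness

variable [IsManifold I ∞ M] [RiemannianBundle (fun x : M ↦ TangentSpace I x)]
  [IsContMDiffRiemannianBundle I ∞ E (fun x : M ↦ TangentSpace I x)]
  {X Y Z W : Π x : M, TangentSpace I x} {p : M}
  {ι : Type*} [Fintype ι] [Nonempty ι] {e : ι → Π x : M, TangentSpace I x}

theorem two_inner_leviCivita (hX : MDiffAt (T% X) p) (hY : MDiffAt (T% Y) p)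
    (hZ : MDiffAt (T% Z) p) :
    2 * inner ℝ (leviCivita I M Y p (X p)) (Z p) = koszul (I := I) X Y Z p :=
  two_inner_leviCivitaFun hX hY hZ

theorem contMDiffAt_koszul (hX : CMDiffAt ∞ (T% X) p) (hY : CMDiffAt ∞ (T% Y) p)
    (hZ : CMDiffAt ∞ (T% Z) p) {V : Π x : M, TangentSpace I x} (hV : CMDiffAt ∞ (T% V) p)
    (hp : V p ≠ 0) : CMDiffAt ∞ (koszul (I := I) X Y Z) p :=
  (((((contMDiffAt_mvfderiv (contMDiffAt_inner hY hZ) hX hV hp).add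
    (contMDiffAt_mvfderiv (contMDiffAt_inner hZ hX) hY hV hp)).sub
    (contMDiffAt_mvfderiv (contMDiffAt_inner hX hY) hZ hV hp)).add
    (contMDiffAt_inner (contMDiffAt_mlieBracket hX hY) hZ)).sub
    (contMDiffAt_inner (contMDiffAt_mlieBracket hX hZ) hY)).sub
    (contMDiffAt_inner (contMDiffAt_mlieBracket hY hZ) hX)

/-- Curvature differentiates `∇^g_X Y` once more. Near `p` its products with the frame are half the
Koszul expression, which is smooth. -/
theorem contMDiffAt_leviCivita (he : ∀ i, CMDiffAt ∞ (T% (e i)) p)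
    (hon : Orthonormal ℝ (fun i ↦ e i p)) (hcard : Fintype.card ι = Module.finrank ℝ E)
    (hX : CMDiffAt ∞ (T% X) p) (hY : CMDiffAt ∞ (T% Y) p) :
    CMDiffAt ∞ (T% (fun y ↦ leviCivita I M Y y (X y))) p := by
  obtain ⟨i₀⟩ := ‹Nonempty ι›
  refine contMDiffAt_section_of_inner he hon hcard fun i ↦ ?_
  have hk := contMDiffAt_koszul hX hY (he i) (he i₀) (hon.ne_zero i₀)
  refine ((contMDiffAt_const (c := (1 / 2 : ℝ))).mul hk).congr_of_eventuallyEq ?_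
  filter_upwards [eventually_mdifferentiableAt_section hX, eventually_mdifferentiableAt_section hY,
    eventually_mdifferentiableAt_section (he i)] with y h1 h2 h3
  rw [Pi.mul_apply, ← two_inner_leviCivita h1 h2 h3]
  ring

theorem contMDiffAt_sharp₂ {T : ThreeForm I M} (hT : T.IsSmooth)
    (he : ∀ i, CMDiffAt ∞ (T% (e i)) p)
    (hon : Orthonormal ℝ (fun i ↦ e i p)) (hcard : Fintype.card ι = Module.finrank ℝ E)
    (hX : CMDiffAt ∞ (T% X) p) (hY : CMDiffAt ∞ (T% Y) p) :
    CMDiffAt ∞ (T% (fun y ↦ sharp₂ (T y) (X y) (Y y))) p := by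
  refine contMDiffAt_section_of_inner he hon hcard fun i ↦ ?_
  simp only [inner_sharp₂]
  exact hT p X Y (e i) hX hY (he i)

theorem mdiffAt_of_smooth (hX : CMDiffAt ∞ (T% X) p) : MDiffAt (T% X) p :=
  hX.mdifferentiableAt (by simp)

theorem leviCivita_sub_swap (hX : MDiffAt (T% X) p) (hY : MDiffAt (T% Y) p) :
    leviCivita I M Y p (X p) - leviCivita I M X p (Y p) = mlieBracket I X Y p := by
  have : IsManifold I 2 M := IsManifold.of_le (n := ∞) (by simp [ENat.LEInfty.out])
  exact (CovariantDerivative.torsion_eq_zero_iff _).1 leviCivita_torsion hX hY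

theorem mvfderiv_congr_of_eventuallyEq {f g : M → ℝ} (h : f =ᶠ[nhds p] g) :
    mvfderiv I f p = mvfderiv I g p := by
  simp only [mvfderiv, h.mfderiv_eq]
  rw [h.eq_of_nhds]

end Smoothness

/-! ### Symmetries of the Riemann tensor. -/

section CurvatureSymmetries

variable [IsManifold I ∞ M] (cov : CovariantDerivative I E (TangentSpace I : M → Type _))
  [RiemannianBundle (fun x : M ↦ TangentSpace I x)]

theorem riem_swap_left (X Y Z W : Π x : M, TangentSpace I x) (p : M) :
    riem cov X Y Z W p = -riem cov Y X Z W p := by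
  have h : mlieBracket I X Y p = -mlieBracket I Y X p := mlieBracket_swap_apply
  simp only [riem, curvature, h, map_neg, inner_sub_left, inner_neg_left]
  ring

variable [IsContMDiffRiemannianBundle I ∞ E (fun x : M ↦ TangentSpace I x)]
  {X Y Z W : Π x : M, TangentSpace I x} {p : M}
  {ι : Type*} [Fintype ι] [Nonempty ι] {e : ι → Π x : M, TangentSpace I x}

theorem mvfderiv_mvfderiv_inner (he : ∀ i, CMDiffAt ∞ (T% (e i)) p)
    (hon : Orthonormal ℝ (fun i ↦ e i p)) (hcard : Fintype.card ι = Module.finrank ℝ E)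
    (hX : CMDiffAt ∞ (T% X) p) (hY : CMDiffAt ∞ (T% Y) p)
    (hZ : CMDiffAt ∞ (T% Z) p) (hW : CMDiffAt ∞ (T% W) p) :
    mvfderiv I (fun y ↦ mvfderiv I (fun z ↦ (inner ℝ (Z z) (W z) : ℝ)) y (Y y)) p (X p)
      = inner ℝ (leviCivita I M (fun y ↦ leviCivita I M Z y (Y y)) p (X p)) (W p)
        + inner ℝ (leviCivita I M Z p (Y p)) (leviCivita I M W p (X p))
        + (inner ℝ (leviCivita I M Z p (X p)) (leviCivita I M W p (Y p))
          + inner ℝ (Z p) (leviCivita I M (fun y ↦ leviCivita I M W y (Y y)) p (X p))) := by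
  have hYZ := mdiffAt_of_smooth (contMDiffAt_leviCivita he hon hcard hY hZ)
  have hYW := mdiffAt_of_smooth (contMDiffAt_leviCivita he hon hcard hY hW)
  have hX' := mdiffAt_of_smooth hX
  have hZ' := mdiffAt_of_smooth hZ
  have hW' := mdiffAt_of_smooth hW
  have h : (fun y ↦ mvfderiv I (fun z ↦ (inner ℝ (Z z) (W z) : ℝ)) y (Y y)) =ᶠ[nhds p]
      fun y ↦ inner ℝ (leviCivita I M Z y (Y y)) (W y)
        + inner ℝ (Z y) (leviCivita I M W y (Y y)) := by
    filter_upwards [eventually_mdifferentiableAt_section hY,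
      eventually_mdifferentiableAt_section hZ, eventually_mdifferentiableAt_section hW]
      with y h1 h2 h3
    exact leviCivita_metric h1 h2 h3
  rw [mvfderiv_congr_of_eventuallyEq h,
    mvfderiv_fun_add (mdiff_inner hYZ hW') (mdiff_inner hZ' hYW), _root_.add_apply,
    leviCivita_metric hX' hYZ hW', leviCivita_metric hX' hZ' hYW]

/-- Metric compatibility applied to `[X, Y]⟨Z, W⟩ = X(Y⟨Z, W⟩) - Y(X⟨Z, W⟩)`; the mixed first-order
terms are symmetric in `X, Y` and cancel. -/
theorem riem_leviCivita_swap_right (he : ∀ i, CMDiffAt ∞ (T% (e i)) p)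
    (hon : Orthonormal ℝ (fun i ↦ e i p)) (hcard : Fintype.card ι = Module.finrank ℝ E)
    (hX : CMDiffAt ∞ (T% X) p) (hY : CMDiffAt ∞ (T% Y) p)
    (hZ : CMDiffAt ∞ (T% Z) p) (hW : CMDiffAt ∞ (T% W) p) :
    riem (leviCivita I M) X Y Z W p = -riem (leviCivita I M) X Y W Z p := by
  obtain ⟨i₀⟩ := id ‹Nonempty ι›
  have h := mvfderiv_mlieBracket (contMDiffAt_inner hZ hW) hX hY (he i₀) (hon.ne_zero i₀)
  rw [mvfderiv_mvfderiv_inner he hon hcard hX hY hZ hW,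
    mvfderiv_mvfderiv_inner he hon hcard hY hX hZ hW,
    leviCivita_metric (mdiffAt_of_smooth (contMDiffAt_mlieBracket hX hY)) (mdiffAt_of_smooth hZ)
      (mdiffAt_of_smooth hW)] at h
  simp only [riem, curvature, inner_sub_left]
  simp only [real_inner_comm (Z p)] at h ⊢
  linarith

/-- Vanishing torsion gives `∇_Y Z = ∇_Z Y + [Y, Z]` on a neighbourhood of `p`, so it may be
differentiated. -/
theorem leviCivita_leviCivita_sub_swap (he : ∀ i, CMDiffAt ∞ (T% (e i)) p)
    (hon : Orthonormal ℝ (fun i ↦ e i p)) (hcard : Fintype.card ι = Module.finrank ℝ E)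
    (hY : CMDiffAt ∞ (T% Y) p) (hZ : CMDiffAt ∞ (T% Z) p) :
    leviCivita I M (fun y ↦ leviCivita I M Z y (Y y)) p
      = leviCivita I M (fun y ↦ leviCivita I M Y y (Z y)) p
        + leviCivita I M (mlieBracket I Y Z) p := by
  have h1 := mdiffAt_of_smooth (contMDiffAt_leviCivita he hon hcard hY hZ)
  have h2 := mdiffAt_of_smooth (contMDiffAt_leviCivita he hon hcard hZ hY)
  have h3 := mdiffAt_of_smooth (contMDiffAt_mlieBracket hY hZ)
  have hcov := (leviCivita I M).isCovariantDerivativeOnUniv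
  rw [← hcov.add h2 h3]
  refine hcov.congr_of_eventuallyEq h1 (mdifferentiableAt_add_section h2 h3) Filter.univ_mem ?_
  filter_upwards [eventually_mdifferentiableAt_section hY, eventually_mdifferentiableAt_section hZ]
    with y h4 h5
  rw [Pi.add_apply, ← leviCivita_sub_swap h4 h5, add_sub_cancel]

/-- The first Bianchi identity. -/
theorem curvature_leviCivita_cyclic (he : ∀ i, CMDiffAt ∞ (T% (e i)) p)
    (hon : Orthonormal ℝ (fun i ↦ e i p)) (hcard : Fintype.card ι = Module.finrank ℝ E)
    (hX : CMDiffAt ∞ (T% X) p) (hY : CMDiffAt ∞ (T% Y) p) (hZ : CMDiffAt ∞ (T% Z) p) :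
    curvature (leviCivita I M) X Y Z p + curvature (leviCivita I M) Y Z X p
      + curvature (leviCivita I M) Z X Y p = 0 := by
  have : IsManifold I (minSmoothness ℝ 3) M :=
    IsManifold.of_le (n := ∞) (by simp [ENat.LEInfty.out])
  have c2 : ∀ {W : Π x : M, TangentSpace I x}, CMDiffAt ∞ (T% W) p →
      CMDiffAt (minSmoothness ℝ 2) (T% W) p := fun h ↦ h.of_le (by simp [ENat.LEInfty.out])
  have torsion {U V : Π x : M, TangentSpace I x} (hU : CMDiffAt ∞ (T% U) p)
      (hV : CMDiffAt ∞ (T% V) p) := leviCivita_sub_swap (mdiffAt_of_smooth hU)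
    (mdiffAt_of_smooth hV)
  have jacobi := leibniz_identity_mlieBracket_apply (c2 hX) (c2 hY) (c2 hZ)
  have s₁ : mlieBracket I (mlieBracket I X Y) Z p = -mlieBracket I Z (mlieBracket I X Y) p :=
    mlieBracket_swap_apply
  have s₂ : mlieBracket I X Z = -mlieBracket I Z X := mlieBracket_swap
  have s₃ : mlieBracket I Y (mlieBracket I X Z) p = -mlieBracket I Y (mlieBracket I Z X) p := by
    have h := mlieBracket_const_smul_right (I := I) (V := Y) (c := (-1 : ℝ))
      (mdiffAt_of_smooth (contMDiffAt_mlieBracket hZ hX))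
    rw [neg_one_smul, neg_one_smul, ← s₂] at h
    exact h
  -- Outer brackets become differences of covariant derivatives, so that the Jacobi identity turns
  -- into the cyclic sum.
  rw [s₁, s₃, ← torsion hX (contMDiffAt_mlieBracket hY hZ),
    ← torsion hZ (contMDiffAt_mlieBracket hX hY), ← torsion hY (contMDiffAt_mlieBracket hZ hX)]
    at jacobi
  simp only [curvature, leviCivita_leviCivita_sub_swap he hon hcard hY hZ,
    leviCivita_leviCivita_sub_swap he hon hcard hZ hX,
    leviCivita_leviCivita_sub_swap he hon hcard hX hY, _root_.add_apply]
  rw [← sub_eq_zero] at jacobi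
  rw [← jacobi]
  abel

theorem riem_leviCivita_cyclic (he : ∀ i, CMDiffAt ∞ (T% (e i)) p)
    (hon : Orthonormal ℝ (fun i ↦ e i p)) (hcard : Fintype.card ι = Module.finrank ℝ E)
    (hX : CMDiffAt ∞ (T% X) p) (hY : CMDiffAt ∞ (T% Y) p) (hZ : CMDiffAt ∞ (T% Z) p) :
    riem (leviCivita I M) X Y Z W p + riem (leviCivita I M) Y Z X W p
      + riem (leviCivita I M) Z X Y W p = 0 := by
  simp only [riem, ← inner_add_left, curvature_leviCivita_cyclic he hon hcard hX hY hZ,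
    inner_zero_left]

end CurvatureSymmetries

/-! ### Curvature of the connection with skew torsion. -/

section SkewTorsionCurvature

variable [IsManifold I ∞ M] [RiemannianBundle (fun x : M ↦ TangentSpace I x)]
  [IsContMDiffRiemannianBundle I ∞ E (fun x : M ↦ TangentSpace I x)]
  {X Y Z W : Π x : M, TangentSpace I x} {p : M}
  {ι : Type*} [Fintype ι] [Nonempty ι] {e : ι → Π x : M, TangentSpace I x}

/-- The covariant derivative `(∇^g_X T)(Y, Z, W)` of a `3`-form. -/
def ThreeForm.covDeriv (T : ThreeForm I M) (X Y Z W : Π x : M, TangentSpace I x) (x : M) : ℝ :=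
  mvfderiv I (T.eval Y Z W) x (X x) - T x ![leviCivita I M Y x (X x), Z x, W x]
    - T x ![Y x, leviCivita I M Z x (X x), W x] - T x ![Y x, Z x, leviCivita I M W x (X x)]

theorem ThreeForm.covDeriv_swap₁ (T : ThreeForm I M) (X Y Z W : Π x : M, TangentSpace I x)
    (x : M) : T.covDeriv X Y Z W x = -T.covDeriv X Z Y W x := by
  have h : T.eval Y Z W = fun x ↦ -T.eval Z Y W x := funext fun y ↦ threeForm_swap (T y) _ _ _
  simp only [covDeriv, h, mvfderiv_fun_neg, _root_.neg_apply]
  linarith [threeForm_swap (T x) (leviCivita I M Y x (X x)) (Z x) (W x),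
    threeForm_swap (T x) (Y x) (leviCivita I M Z x (X x)) (W x),
    threeForm_swap (T x) (Y x) (Z x) (leviCivita I M W x (X x))]

theorem ThreeForm.covDeriv_swap₂ (T : ThreeForm I M) (X Y Z W : Π x : M, TangentSpace I x)
    (x : M) : T.covDeriv X Y Z W x = -T.covDeriv X Y W Z x := by
  have h : T.eval Y Z W = fun x ↦ -T.eval Y W Z x := funext fun y ↦ threeForm_swap₂ (T y) _ _ _
  simp only [covDeriv, h, mvfderiv_fun_neg, _root_.neg_apply]
  linarith [threeForm_swap₂ (T x) (leviCivita I M Y x (X x)) (Z x) (W x),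
    threeForm_swap₂ (T x) (Y x) (leviCivita I M Z x (X x)) (W x),
    threeForm_swap₂ (T x) (Y x) (Z x) (leviCivita I M W x (X x))]

/-- With `[U, V] = ∇^g_U V - ∇^g_V U`, the bracket terms of `dT` are exactly the connection terms on
the right. -/
theorem ThreeForm.extDeriv_eq_covDeriv (T : ThreeForm I M) (hX : MDiffAt (T% X) p)
    (hY : MDiffAt (T% Y) p) (hZ : MDiffAt (T% Z) p) (hW : MDiffAt (T% W) p) :
    T.extDeriv X Y Z W p = T.covDeriv X Y Z W p - T.covDeriv Y X Z W p + T.covDeriv Z X Y W p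
      - T.covDeriv W X Y Z p := by
  have s₂ : ∀ u v w, T p ![u, v, w] = -T p ![v, u, w] := threeForm_swap (T p)
  have s₃ : ∀ u v w, T p ![u, v, w] = T p ![w, u, v] := fun u v w ↦ by
    rw [threeForm_swap₂, threeForm_swap, neg_neg]
  have b : ∀ {U V A B : Π x : M, TangentSpace I x}, MDiffAt (T% U) p → MDiffAt (T% V) p →
      T.eval (mlieBracket I U V) A B p = T p ![leviCivita I M V p (U p), A p, B p]
        - T p ![leviCivita I M U p (V p), A p, B p] := fun hU hV ↦ by
    rw [ThreeForm.eval, ← leviCivita_sub_swap hU hV, threeForm_sub₁]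
  simp only [extDeriv, covDeriv, b hX hY, b hX hZ, b hX hW, b hY hZ, b hY hW, b hZ hW,
    s₂ _ (leviCivita I M _ p _) _, s₃ _ _ (leviCivita I M _ p _)]
  ring

theorem inner_torsionConnection_torsionConnection {T : ThreeForm I M} (hT : T.IsSmooth) (s : ℝ)
    (he : ∀ i, CMDiffAt ∞ (T% (e i)) p)
    (hon : Orthonormal ℝ (fun i ↦ e i p)) (hcard : Fintype.card ι = Module.finrank ℝ E)
    (hX : CMDiffAt ∞ (T% X) p) (hY : CMDiffAt ∞ (T% Y) p)
    (hZ : CMDiffAt ∞ (T% Z) p) (hW : CMDiffAt ∞ (T% W) p) :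
    inner ℝ (torsionConnection s T (fun y ↦ torsionConnection s T Z y (Y y)) p (X p)) (W p)
      = inner ℝ (leviCivita I M (fun y ↦ leviCivita I M Z y (Y y)) p (X p)) (W p)
        + s * (mvfderiv I (T.eval Y Z W) p (X p) - T p ![Y p, Z p, leviCivita I M W p (X p)]
          + T p ![X p, leviCivita I M Z p (Y p), W p])
        - s ^ 2 * inner ℝ (sharp₂ (T p) (X p) (W p)) (sharp₂ (T p) (Y p) (Z p)) := by
  have h1 := mdiffAt_of_smooth (contMDiffAt_leviCivita he hon hcard hY hZ)
  have h2 := mdiffAt_of_smooth (contMDiffAt_sharp₂ hT he hon hcard hY hZ)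
  have h2s := mdiffAt_of_smooth (ContMDiffAt.const_smul_section (a := s)
    (contMDiffAt_sharp₂ hT he hon hcard hY hZ))
  have hcov := (leviCivita I M).isCovariantDerivativeOnUniv
  have h3 : leviCivita I M (fun y ↦ torsionConnection s T Z y (Y y)) p
      = leviCivita I M (fun y ↦ leviCivita I M Z y (Y y)) p
        + s • leviCivita I M (fun y ↦ sharp₂ (T y) (Y y) (Z y)) p := by
    rw [← hcov.smul_const s h2, ← hcov.add h1 h2s]
    rfl
  -- Metric compatibility for `⟨T(Y, Z, ·)^♯, W⟩ = T(Y, Z, W)`.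
  have h4 : mvfderiv I (T.eval Y Z W) p (X p)
      = inner ℝ (leviCivita I M (fun y ↦ sharp₂ (T y) (Y y) (Z y)) p (X p)) (W p)
        + T p ![Y p, Z p, leviCivita I M W p (X p)] := by
    rw [← inner_sharp₂, ← leviCivita_metric (mdiffAt_of_smooth hX) h2 (mdiffAt_of_smooth hW)]
    simp only [inner_sharp₂]
    rfl
  rw [torsionConnection_apply, h3, torsionConnection_apply, h4]
  simp only [_root_.add_apply, _root_.smul_apply, inner_add_left, real_inner_smul_left,
    inner_sharp₂, threeForm_add₂, threeForm_smul₂]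
  rw [threeForm_swap₂ (T p) (X p) (sharp₂ _ _ _)]
  ring

/-- Skew-symmetrise the second derivative in `X, Y`: the terms linear in `s` assemble into covariant
derivatives of `T` once `[X, Y]` is written through `∇^g`. -/
theorem riem_torsionConnection {T : ThreeForm I M} (hT : T.IsSmooth) (s : ℝ)
    (he : ∀ i, CMDiffAt ∞ (T% (e i)) p)
    (hon : Orthonormal ℝ (fun i ↦ e i p)) (hcard : Fintype.card ι = Module.finrank ℝ E)
    (hX : CMDiffAt ∞ (T% X) p) (hY : CMDiffAt ∞ (T% Y) p)
    (hZ : CMDiffAt ∞ (T% Z) p) (hW : CMDiffAt ∞ (T% W) p) :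
    riem (torsionConnection s T) X Y Z W p
      = riem (leviCivita I M) X Y Z W p + s * (T.covDeriv X Y Z W p - T.covDeriv Y X Z W p)
        + s ^ 2 * (inner ℝ (sharp₂ (T p) (Y p) (W p)) (sharp₂ (T p) (X p) (Z p))
          - inner ℝ (sharp₂ (T p) (X p) (W p)) (sharp₂ (T p) (Y p) (Z p))) := by
  have hb := leviCivita_sub_swap (mdiffAt_of_smooth hX) (mdiffAt_of_smooth hY)
  simp only [riem, curvature, inner_sub_left,
    inner_torsionConnection_torsionConnection hT s he hon hcard hX hY hZ hW,
    inner_torsionConnection_torsionConnection hT s he hon hcard hY hX hZ hW]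
  rw [torsionConnection_apply, inner_add_left, real_inner_smul_left, ← hb]
  simp only [inner_sharp₂, threeForm_sub₁, ThreeForm.covDeriv]
  ring

/-- Parseval's identity, which brings the quadratic terms into the component form of `quadCurv` and
of `B(T)`. -/
theorem inner_sharp₂_sharp₂ {T : ThreeForm I M} (hon : Orthonormal ℝ (fun i ↦ e i p))
    (hcard : Fintype.card ι = Module.finrank ℝ E) (u v u' v' : TangentSpace I p) :
    inner ℝ (sharp₂ (T p) u v) (sharp₂ (T p) u' v')
      = ∑ m, T p ![u, v, e m p] * T p ![u', v', e m p] := by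
  have hspan := hon.linearIndependent.span_eq_top_of_card_eq_finrank' hcard
  have h := (OrthonormalBasis.mk hon hspan.ge).sum_inner_mul_inner (sharp₂ (T p) u v)
    (sharp₂ (T p) u' v')
  rw [← h]
  refine Finset.sum_congr rfl fun m _ ↦ ?_
  rw [OrthonormalBasis.coe_mk, real_inner_comm (sharp₂ _ u' v'), inner_sharp₂, inner_sharp₂]

end SkewTorsionCurvature
end SkewTorsion

end

theorem mainTheorem8 {M : Type*} [TopologicalSpace M]
    [ChartedSpace (EuclideanSpace ℝ (Fin 4)) M] [IsManifold (𝓡 4) ∞ M]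
    [RiemannianBundle (fun x : M ↦ TangentSpace (𝓡 4) x)]
    [IsContMDiffRiemannianBundle (𝓡 4) ∞ (EuclideanSpace ℝ (Fin 4))
      (fun x : M ↦ TangentSpace (𝓡 4) x)]
    (T : SkewTorsion.ThreeForm (𝓡 4) M) (hT : T.IsSmooth) (s : ℝ) (p : M)
    (e : Fin 4 → Π x : M, TangentSpace (𝓡 4) x)
    (he : ∀ i, ContMDiffAt (𝓡 4) ((𝓡 4).prod 𝓘(ℝ, EuclideanSpace ℝ (Fin 4))) ∞
      (fun x ↦ (⟨x, e i x⟩ : TangentBundle (𝓡 4) M)) p)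
    (hon : Orthonormal ℝ (fun i ↦ e i p)) :
    SkewTorsion.normSq₄ e (SkewTorsion.riem (SkewTorsion.torsionConnection s T)) p
      = SkewTorsion.normSq₄ e (SkewTorsion.riem (SkewTorsion.leviCivita (𝓡 4) M)) p
        + (1 / 3 : ℝ) * s ^ 4 * SkewTorsion.normSq₃ e T p ^ 2
        + (1 / 4 : ℝ) * s ^ 2 * SkewTorsion.normSq₄ e T.extDeriv p
        - (1 / 3 : ℝ) * s ^ 2
            * SkewTorsion.scalarCurvature (SkewTorsion.leviCivita (𝓡 4) M) e p
            * SkewTorsion.normSq₃ e T p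
        + 4 * s ^ 2 * SkewTorsion.ricciCoupling e T p
        + SkewTorsion.normSq₄ e
            (SkewTorsion.riemAnti (SkewTorsion.torsionConnection s T)) p := by
  have hcard : Fintype.card (Fin 4) = Module.finrank ℝ (EuclideanSpace ℝ (Fin 4)) := by simp
  have md := fun i ↦ SkewTorsion.mdiffAt_of_smooth (he i)
  have h := SkewTorsion.sum_sq_curvature (s := s)
    (r := fun i j k l ↦ SkewTorsion.riem (SkewTorsion.leviCivita (𝓡 4) M) (e i) (e j) (e k) (e l) p)
    (D := fun i j k l ↦ T.covDeriv (e i) (e j) (e k) (e l) p)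
    (F := fun i j k l ↦
      SkewTorsion.riem (SkewTorsion.torsionConnection s T) (e i) (e j) (e k) (e l) p)
    (w := fun i j k l ↦ T.extDeriv (e i) (e j) (e k) (e l) p)
    (t := fun i j k ↦ T p ![e i p, e j p, e k p])
    (fun i j k l ↦ SkewTorsion.riem_swap_left _ _ _ _ _ _)
    (fun i j k l ↦ SkewTorsion.riem_leviCivita_swap_right he hon hcard (he i) (he j) (he k) (he l))
    (fun i j k l ↦ SkewTorsion.riem_leviCivita_cyclic he hon hcard (he i) (he j) (he k))
    (fun i j k ↦ SkewTorsion.threeForm_swap (T p) _ _ _)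
    (fun i j k ↦ SkewTorsion.threeForm_swap₂ (T p) _ _ _)
    (fun i j k l ↦ T.covDeriv_swap₁ _ _ _ _ _) (fun i j k l ↦ T.covDeriv_swap₂ _ _ _ _ _)
    (fun i j k l ↦ T.extDeriv_eq_covDeriv (md i) (md j) (md k) (md l))
    (fun i j k l ↦ by
      rw [SkewTorsion.riem_torsionConnection hT s he hon hcard (he i) (he j) (he k) (he l),
        SkewTorsion.inner_sharp₂_sharp₂ hon hcard, SkewTorsion.inner_sharp₂_sharp₂ hon hcard]
      rfl)
  simp only [SkewTorsion.ricciCoupling, SkewTorsion.inner_sharp₂_sharp₂ hon hcard]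
  exact h
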